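/- Let $A\in\mathbb R^{n\times n}$, $B\in\mathbb R^{n\times m}$, $C\in\mathbb R^{p\times n}$, $D\in\mathbb R^{p\times m}$, let $\Sigma$ be the linear system $\dot x(t)=Ax(t)+Bu(t)$, $x(0)=x_0$, $y(t)=Cx(t)+Du(t)$ $(t\ge 0)$, and put $\rho=\dim(\ker B\cap\ker D)$. Inputs $u$ are causal (zero for $t<0$), piecewise continuous and exponentially bounded; the corresponding states $x$ are continuous and the outputs $y$ piecewise continuous on $[0,\infty)$. Signals are regarded as equal if they agree at almost every $t\ge 0$. Let $\mathcal U\subseteq\mathbb R^m$ and $\mathcal X\subseteq\mathbb R^n$ be arbitrary sets and let $\mathfrak S$ be the system $\Sigma$ with the constraints $u(t)\in\mathcal U$, $x(t)\in\mathcal X$ for all $t\ge 0$. For $x_0\in\mathbb R^n$ let $\mathbf Q(x_0)$ be the set of triples $(u,x,y)$ of input, state and output that satisfy the equations of $\Sigma$ with initial state $x_0$ and these constraints. A pair $(x_0,y)$, with $x_0\in\mathcal X$ and $y$ piecewise continuous, is admissible if $(u,x,y)\in\mathbf Q(x_0)$ for some $(u,x)$, and it is input redundant for $\mathfrak S$ if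 there are $(u_1,x_1,y),(u_2,x_2,y)\in\mathbf Q(x_0)$ with $u_1\neq u_2$. The system $\mathfrak S$ is input redundant if it has an input redundant pair; for $\Sigma$ the same is meant with $\mathcal U=\mathbb R^m$, $\mathcal X=\mathbb R^n$. Assume that $\Sigma$ is input redundant and that $(x_0,y)$ is admissible but not input redundant for $\mathfrak S$. Then there is a unique $(u,x)$ with $(u,x,y)\in\mathbf Q(x_0)$, and, with $\mathcal C$ the largest (relatively) open subset of $[0,\infty)$ on which $u$ is continuous (whichever almost-everywhere equal representative of $u$ in $\mathbf Q(x_0)$ is taken): - if $\rho>0$, then $u(t)\in\mathcal U\setminus\operatorname{int}(\mathcal U)$ for all $t\in\mathcal C$; - if $\rho=0$, then for every $t\in\mathcal C$, $u(t)\in\mathcal U\setminus\operatorname{int}(\mathcal U)$ or $x(t)\in\mathcal X\setminus\operatorname{int}(\mathcal X)$. -/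

import Mathlib

open Set Filter Topology MeasureTheory

/-- Vector-valued signals on the time axis `[0, ∞)`. A signal is represented by a function on `ℝ`;
only its values at nonnegative times matter in what follows. (Only the topology of `ℝᵏ` and
boundedness up to a constant factor are used, so the choice of norm on `Fin k → ℝ` is immaterial.) -/
abbrev Signal (k : ℕ) : Type := ℝ → (Fin k → ℝ)

namespace Signal

variable {k : ℕ}

/-- Equality of signals: equality at almost every time `t ≥ 0`. -/
def AEEq (f g : Signal k) : Prop :=
  f =ᵐ[volume.restrict (Ici (0 : ℝ))] g

/-- Piecewise continuity on `[0, ∞)`: finitely many discontinuities on every bounded interval, and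
finite one-sided limits everywhere. Continuity is relative to `[0, ∞)`, so at `0` it is continuity
from the right. -/
def PiecewiseContinuous (f : Signal k) : Prop :=
  (∀ T : ℝ, {t : ℝ | t ∈ Icc 0 T ∧ ¬ ContinuousWithinAt f (Ici 0) t}.Finite) ∧
  (∀ t : ℝ, 0 ≤ t → ∃ l : Fin k → ℝ, Tendsto f (𝓝[>] t) (𝓝 l)) ∧
  (∀ t : ℝ, 0 < t → ∃ l : Fin k → ℝ, Tendsto f (𝓝[<] t) (𝓝 l))

/-- Causality: the signal is zero at all strictly negative times. -/
def Causal (f : Signal k) : Prop := ∀ t : ℝ, t < 0 → f t = 0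

/-- Exponential boundedness on `[0, ∞)`. -/
def ExpBounded (f : Signal k) : Prop :=
  ∃ M a : ℝ, ∀ t : ℝ, 0 ≤ t → ‖f t‖ ≤ M * Real.exp (a * t)

/-- The largest (relatively) open subset of `[0, ∞)` on which the signal is continuous: the union of
all such subsets. -/
def continuitySet (f : Signal k) : Set ℝ :=
  ⋃₀ {O : Set ℝ | (∃ W : Set ℝ, IsOpen W ∧ O = W ∩ Ici 0) ∧ ContinuousOn f O}

end Signal

/-- The inputs of the unconstrained system: causal, piecewise continuous, exponentially bounded. -/
def freeInputs (m : ℕ) : Set (Signal m) :=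
  {u | u.Causal ∧ u.PiecewiseContinuous ∧ u.ExpBounded}

/-- The states of the unconstrained system: continuous on `[0, ∞)`. -/
def freeStates (n : ℕ) : Set (Signal n) := {x | ContinuousOn x (Ici 0)}

/-- The outputs: piecewise continuous on `[0, ∞)`. -/
def outputs (p : ℕ) : Set (Signal p) := {y | y.PiecewiseContinuous}

/-- The inputs with values in `U`. -/
def inputs {m : ℕ} (U : Set (Fin m → ℝ)) : Set (Signal m) :=
  {u | ∀ t : ℝ, 0 ≤ t → u t ∈ U} ∩ freeInputs m

/-- The states with values in `X`. -/
def states {n : ℕ} (X : Set (Fin n → ℝ)) : Set (Signal n) :=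
  {x | ∀ t : ℝ, 0 ≤ t → x t ∈ X} ∩ freeStates n

/-- The linear time-invariant system `x' = A x + B u`, `y = C x + D u`, with `m` inputs, `n` states
and `p` outputs. -/
structure LinearSystem (m n p : ℕ) where
  /-- the state matrix -/
  A : Matrix (Fin n) (Fin n) ℝ
  /-- the input matrix -/
  B : Matrix (Fin n) (Fin m) ℝ
  /-- the output matrix -/
  C : Matrix (Fin p) (Fin n) ℝ
  /-- the feedthrough matrix -/
  D : Matrix (Fin p) (Fin m) ℝ

namespace LinearSystem

variable {m n p : ℕ} (S : LinearSystem m n p)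

/-- `x` is the state trajectory produced by the input `u` from the initial state `x₀`. As `u` is only
piecewise continuous, `x' = A x + B u`, `x(0) = x₀` is read in integrated form. -/
def IsStateTrajectory (x₀ : Fin n → ℝ) (u : Signal m) (x : Signal n) : Prop :=
  ContinuousOn x (Ici 0) ∧
  ∀ t : ℝ, 0 ≤ t → x t = x₀ + ∫ s in (0 : ℝ)..t, (S.A.mulVec (x s) + S.B.mulVec (u s))

/-- The triples `(u, x, y)` compatible for `x₀` with the unconstrained system. -/
def freeTriples (x₀ : Fin n → ℝ) : Set (Signal m × Signal n × Signal p) :=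
  {q | q.1 ∈ freeInputs m ∧ S.IsStateTrajectory x₀ q.1 q.2.1 ∧
    Signal.AEEq q.2.2 (fun t => S.C.mulVec (q.2.1 t) + S.D.mulVec (q.1 t))}

/-- The triples `(u, x, y)` compatible for `x₀` with the system under the constraints
`u(t) ∈ U`, `x(t) ∈ X`. -/
def triples (U : Set (Fin m → ℝ)) (X : Set (Fin n → ℝ)) (x₀ : Fin n → ℝ) :
    Set (Signal m × Signal n × Signal p) :=
  S.freeTriples x₀ ∩ (inputs U ×ˢ (states X ×ˢ outputs p))

/-- The input-output pairs compatible for `x₀` with the constrained system. -/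
def ioPairs (U : Set (Fin m → ℝ)) (X : Set (Fin n → ℝ)) (x₀ : Fin n → ℝ) :
    Set (Signal m × Signal p) :=
  {w | ∃ x : Signal n, (w.1, x, w.2) ∈ S.triples U X x₀}

/-- The admissible pairs `(x₀, y)` of the constrained system. -/
def admissiblePairs (U : Set (Fin m → ℝ)) (X : Set (Fin n → ℝ)) :
    Set ((Fin n → ℝ) × Signal p) :=
  {a | a ∈ X ×ˢ outputs p ∧ ∃ u : Signal m, (u, a.2) ∈ S.ioPairs U X a.1}

/-- The input redundant pairs `(x₀, y)` of the constrained system: the output `y` is produced from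
`x₀` by two distinct inputs. -/
def redundantPairs (U : Set (Fin m → ℝ)) (X : Set (Fin n → ℝ)) :
    Set ((Fin n → ℝ) × Signal p) :=
  {a | a ∈ X ×ˢ outputs p ∧
    ∃ (u₁ : Signal m) (y₁ : Signal p) (u₂ : Signal m) (y₂ : Signal p),
      (u₁, y₁) ∈ S.ioPairs U X a.1 ∧ (u₂, y₂) ∈ S.ioPairs U X a.1 ∧
      ¬ Signal.AEEq u₁ u₂ ∧ Signal.AEEq y₁ y₂ ∧ Signal.AEEq y₂ a.2}

/-- The constrained system is input redundant if it has an input redundant pair. -/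
def IsInputRedundant (U : Set (Fin m → ℝ)) (X : Set (Fin n → ℝ)) : Prop :=
  (S.redundantPairs U X).Nonempty

/-- `ρ = dim (ker B ∩ ker D)`. -/
noncomputable def rho : ℕ :=
  Module.finrank ℝ
    (LinearMap.ker S.B.mulVecLin ⊓ LinearMap.ker S.D.mulVecLin : Submodule ℝ (Fin m → ℝ))

end LinearSystem

/-! Uniqueness of `u` is the failure of redundancy, and `u` determines `x` by uniqueness for linear
Volterra equations. For the boundary claims, suppose the constraints leave room at a continuity time
`t`. If some nonzero input `w`, supported in a short interval just after `t`, moves the state from 0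
back to 0 without affecting the output, then `u + ε w` is a second input producing `y`, a
contradiction (`exists_triples_ne`).

Such `w` are found algebraically. Continuous functions form an `ℝ[X]`-module in which `X` acts as
integration from 0, and this module is torsion-free. Redundancy of the unconstrained system gives a
nonzero output nulling trajectory, whose components span a finitely generated torsion-free, hence
free, module over a principal ideal domain. A coordinate functional turns the trajectory into
polynomials `ξ`, `ω` obeying the same equations, with `ω ≠ 0` (`exists_isOutputNulling`). Applying
them to a high derivative of a bump function gives signals supported where the bump is
(`exists_signals`). If `ρ > 0`, a constant `ω` with `ξ = 0` works, so the state is not disturbed at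
all. -/

/-- A continuous solution of the homogeneous linear Volterra equation `G(t) = ∫₀ᵗ L G` vanishes. -/
theorem eq_zero_of_eq_integral {E : Type*} [NormedAddCommGroup E] [NormedSpace ℝ E]
    [FiniteDimensional ℝ E] (L : E →ₗ[ℝ] E) {G : ℝ → E} (hG : Continuous G)
    (h : ∀ t, G t = ∫ s in (0 : ℝ)..t, L (G s)) : G = 0 := by
  have : CompleteSpace E := FiniteDimensional.complete ℝ E
  let L' : E →L[ℝ] E := LinearMap.toContinuousLinearMap L
  have hcont : Continuous fun s => L (G s) := L'.continuous.comp hG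
  refine ODE_solution_unique_univ (v := fun _ => L') (s := fun _ => univ) (K := ‖L'‖₊) (t₀ := 0)
    (fun _ => L'.lipschitz.lipschitzOnWith) (fun t => ⟨?_, mem_univ _⟩) (fun t => ⟨?_, mem_univ _⟩) ?_
  · have h1 := intervalIntegral.integral_hasDerivAt_right (hcont.intervalIntegrable 0 t)
      (hcont.stronglyMeasurableAtFilter _ _) hcont.continuousAt
    rwa [← funext h] at h1
  · simp
  · rw [h 0]; simp

/-! ### Polynomials in the integration operator. -/

/-- The primitive vanishing at `0`, as an operator on continuous functions. -/
noncomputable def primitive : C(ℝ, ℝ) →ₗ[ℝ] C(ℝ, ℝ) where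
  toFun f := ⟨fun t => ∫ s in (0 : ℝ)..t, f s,
    intervalIntegral.continuous_primitive (fun a b => f.continuous.intervalIntegrable a b) 0⟩
  map_add' f g := by
    ext t
    exact intervalIntegral.integral_add (f.continuous.intervalIntegrable 0 t)
      (g.continuous.intervalIntegrable 0 t)
  map_smul' c f := by
    ext t
    exact intervalIntegral.integral_const_mul c f

theorem primitive_apply (f : C(ℝ, ℝ)) (t : ℝ) : primitive f t = ∫ s in (0 : ℝ)..t, f s := rfl

theorem hasDerivAt_primitive (f : C(ℝ, ℝ)) (t : ℝ) : HasDerivAt (primitive f) (f t) t :=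
  intervalIntegral.integral_hasDerivAt_right (f.continuous.intervalIntegrable 0 t)
    (f.continuous.stronglyMeasurableAtFilter _ _) f.continuous.continuousAt

theorem eq_zero_of_primitive_eq_zero {f : C(ℝ, ℝ)} (h : primitive f = 0) : f = 0 := by
  ext t
  have h1 := hasDerivAt_primitive f t
  rw [h] at h1
  exact h1.unique (hasDerivAt_const t (0 : ℝ))

theorem primitive_pow_succ_apply (k : ℕ) (f : C(ℝ, ℝ)) :
    (primitive ^ (k + 1)) f = primitive ((primitive ^ k) f) := by
  rw [pow_succ']; rfl

/-- The iterated primitives of `f` form a vector `G` solving `G' = L G`, `G(0) = 0`, with `L` a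
companion matrix; so `G`, and with it `f`, vanishes. -/
theorem eq_zero_of_eq_sum_primitive_pow {d : ℕ} (a : Fin d → ℝ) {f : C(ℝ, ℝ)}
    (h : f = ∑ i, a i • (primitive ^ (i.1 + 1)) f) : f = 0 := by
  let L : (Fin d → ℝ) →ₗ[ℝ] (Fin d → ℝ) :=
    { toFun := fun x i => if i.1 = 0 then ∑ j, a j * x j else x ⟨i.1 - 1, by omega⟩
      map_add' := fun x y => by
        ext i
        by_cases hi : i.1 = 0 <;> simp [hi, mul_add, Finset.sum_add_distrib]
      map_smul' := fun c x => by
        ext i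
        by_cases hi : i.1 = 0 <;> simp [hi, Finset.mul_sum, mul_left_comm] }
  let G : ℝ → Fin d → ℝ := fun t i => (primitive ^ (i.1 + 1)) f t
  have hf : ∀ t, f t = ∑ j, a j * G t j := fun t => by
    conv_lhs => rw [h]
    simp [G, ContinuousMap.sum_apply]
  have hL : ∀ t i, L (G t) i = (primitive ^ i.1) f t := by
    intro t i
    by_cases hi : i.1 = 0
    · simp [L, hi, hf t]
    · have : i.1 - 1 + 1 = i.1 := by omega
      simp [L, hi, G, this]
  have hGc : Continuous G := continuous_pi fun i => ContinuousMap.continuous _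
  have hLc : Continuous fun t => L (G t) := (LinearMap.continuous_of_finiteDimensional L).comp hGc
  have hG0 : G = 0 := by
    refine eq_zero_of_eq_integral L hGc fun t => ?_
    ext i
    have := (ContinuousLinearMap.proj (R := ℝ) (φ := fun _ : Fin d => ℝ) i).intervalIntegral_comp_comm
      (hLc.intervalIntegrable (μ := volume) 0 t)
    simp only [ContinuousLinearMap.proj_apply] at this
    rw [← this]
    simp_rw [hL]
    change (primitive ^ (i.1 + 1)) f t = _
    rw [primitive_pow_succ_apply, primitive_apply]
  ext t
  rw [hf t, hG0]
  simp

open Polynomial in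
/-- The operator `p(J)`, with `J` the primitive and `p ≠ 0` a polynomial, is injective. -/
theorem eq_zero_of_aeval_primitive_eq_zero {p : ℝ[X]} (hp : p ≠ 0) {f : C(ℝ, ℝ)}
    (h : aeval primitive p f = 0) : f = 0 := by
  induction hn : p.natDegree using Nat.strong_induction_on generalizing p with
  | _ n ih =>
    have hdec := p.divX_mul_X_add
    have hev : aeval primitive p f = (aeval primitive p.divX) (primitive f) + p.coeff 0 • f := by
      conv_lhs => rw [← hdec]
      simp [Algebra.algebraMap_eq_smul_one]
    -- Without constant term, a factor `X` is cancelled because integration is injective. Otherwise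
    -- division by the constant term leaves a Volterra equation for `f`.
    by_cases hc : p.coeff 0 = 0
    · have hq : p.divX ≠ 0 := by
        intro hq
        rw [hq, hc] at hdec
        exact hp (by simpa using hdec.symm)
      have hX : p = X * p.divX := by
        conv_lhs => rw [← hdec, hc]
        simp [mul_comm]
      have hdeg : p.divX.natDegree < n := by
        have := congrArg natDegree hX
        rw [natDegree_X_mul hq] at this
        omega
      refine ih _ hdeg hq (eq_zero_of_primitive_eq_zero ?_) rfl
      rw [hX] at h
      simpa using h
    · refine eq_zero_of_eq_sum_primitive_pow (d := p.divX.natDegree + 1)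
        (fun i => -(p.coeff 0)⁻¹ * p.divX.coeff i) ?_
      rw [hev, aeval_eq_sum_range, ← Fin.sum_univ_eq_sum_range
        (fun i => p.divX.coeff i • primitive ^ i)] at h
      have h2 : f = -(p.coeff 0)⁻¹ •
          (∑ i : Fin (p.divX.natDegree + 1), p.divX.coeff i • primitive ^ i.1) (primitive f) := by
        rw [eq_neg_of_add_eq_zero_left h, smul_neg, neg_smul, neg_neg, smul_smul,
          inv_mul_cancel₀ hc, one_smul]
      conv_lhs => rw [h2]
      simp [Finset.smul_sum, smul_smul, pow_succ, LinearMap.sum_apply]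

/-- Take `ψ` to be the `N`-th derivative of `φ`. As `0 < a`, all derivatives of `φ` vanish at 0, so
integrating from 0 undoes differentiation and each iterated primitive is a lower derivative of `φ`.
-/
theorem exists_primitive_pow_eq_of_contDiff {φ : ℝ → ℝ} {a b : ℝ} (ha : 0 < a)
    (hφ : ContDiff ℝ (⊤ : ℕ∞) φ) (hsupp : ∀ t, t ∉ Icc a b → φ t = 0) (N : ℕ) :
    ∃ ψ : C(ℝ, ℝ), (⇑((primitive ^ N) ψ) = φ) ∧
      ∀ k ≤ N, ∀ t, t ∉ Icc a b → (primitive ^ k) ψ t = 0 := by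
  induction N generalizing φ with
  | zero =>
    refine ⟨⟨φ, hφ.continuous⟩, rfl, fun k hk t ht => ?_⟩
    obtain rfl : k = 0 := by omega
    exact hsupp t ht
  | succ N ih =>
    have hd : ContDiff ℝ (⊤ : ℕ∞) (deriv φ) := (contDiff_infty_iff_deriv.1 hφ).2
    have hs : ∀ t, t ∉ Icc a b → deriv φ t = 0 := by
      intro t ht
      have : φ =ᶠ[𝓝 t] fun _ => 0 := by
        filter_upwards [isClosed_Icc.isOpen_compl.mem_nhds ht] with s hs using hsupp s hs
      rw [this.deriv_eq]; simp
    obtain ⟨ψ, hψ, hk⟩ := ih hd hs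
    have key : ⇑((primitive ^ (N + 1)) ψ) = φ := by
      ext t
      rw [primitive_pow_succ_apply, primitive_apply, hψ,
        intervalIntegral.integral_eq_sub_of_hasDerivAt
          (fun x _ => (hφ.differentiable (by simp)).differentiableAt.hasDerivAt)
          (hd.continuous.intervalIntegrable _ _),
        hsupp 0 (fun h => absurd h.1 (not_le.2 ha)), sub_zero]
    refine ⟨ψ, key, fun k hkN t ht => ?_⟩
    rcases Nat.lt_or_ge N k with h | h
    · obtain rfl : k = N + 1 := by omega
      rw [key]; exact hsupp t ht
    · exact hk k h t ht

open Polynomial in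
/-- For every `N` there is a nonzero continuous function all of whose images under polynomials of
degree at most `N` in the primitive are supported in a given interval. -/
theorem exists_aeval_primitive_support {a b : ℝ} (ha : 0 < a) (hab : a < b) (N : ℕ) :
    ∃ ψ : C(ℝ, ℝ), ψ ≠ 0 ∧
      ∀ p : ℝ[X], p.natDegree ≤ N → ∀ t, t ∉ Icc a b → aeval primitive p ψ t = 0 := by
  obtain ⟨φ, hsub, -, hφ, -, h1⟩ := exists_contDiff_tsupport_subset (n := ⊤)
    (Icc_mem_nhds (show a < (a + b) / 2 by linarith) (show (a + b) / 2 < b by linarith))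
  obtain ⟨ψ, hψ, hk⟩ := exists_primitive_pow_eq_of_contDiff ha hφ
    (fun t ht => by_contra fun h => ht (hsub (subset_tsupport _ h))) N
  refine ⟨ψ, ?_, fun p hp t ht => ?_⟩
  · rintro rfl
    rw [map_zero] at hψ
    rw [← hψ] at h1
    simp at h1
  · rw [aeval_eq_sum_range, LinearMap.sum_apply, ContinuousMap.sum_apply]
    refine Finset.sum_eq_zero fun k hkr => ?_
    have : k ≤ N := by have := Finset.mem_range.1 hkr; omega
    simp [hk k this t ht]

/-! ### From trajectories to polynomials. -/

open Polynomial in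
theorem isTorsionFree_aeval_primitive : Module.IsTorsionFree ℝ[X] (Module.AEval' primitive) := by
  refine Module.IsTorsionFree.of_smul_eq_zero fun p x h => ?_
  obtain ⟨f, rfl⟩ := (Module.AEval'.of primitive).surjective x
  rw [← Module.AEval.of_aeval_smul] at h
  by_cases hp : p = 0
  · exact Or.inl hp
  · right
    have := (Module.AEval'.of primitive).map_eq_zero_iff.1 h
    rw [eq_zero_of_aeval_primitive_eq_zero hp this, map_zero]

/-- In a torsion-free module over a principal ideal domain, the members of a finite family that do
not all vanish are separated from `0` by a linear functional on their span. -/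
theorem exists_functional_ne_zero {R M ι : Type*} [CommRing R] [IsDomain R]
    [IsPrincipalIdealRing R] [AddCommGroup M] [Module R M] [Module.IsTorsionFree R M] [Finite ι]
    (w : ι → M) (i : ι) (hi : w i ≠ 0) :
    ∃ f : Submodule.span R (range w) →ₗ[R] R,
      f ⟨w i, Submodule.subset_span (mem_range_self i)⟩ ≠ 0 := by
  have : Module.Finite R (Submodule.span R (range w)) :=
    Module.Finite.span_of_finite R (finite_range w)
  have hfree : Module.Free R (Submodule.span R (range w)) := inferInstance
  by_contra! h
  refine hi ?_
  have := (Module.Free.chooseBasis R (Submodule.span R (range w))).ext_elem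
    (x := ⟨w i, Submodule.subset_span (mem_range_self i)⟩) (y := 0) fun j => by
      simpa using h ((Module.Free.chooseBasis R (Submodule.span R (range w))).coord j)
  exact congrArg Subtype.val this

namespace LinearSystem

variable {m n p : ℕ} (S : LinearSystem m n p)

open Polynomial in
/-- Polynomials `ξ`, `ω` in the integration operator `σ` with `ξ = σ (A ξ + B ω)` and
`C ξ + D ω = 0`: applied to any continuous function they give a state and an input with zero
initial state and zero output. -/
structure IsOutputNulling (ξ : Fin n → ℝ[X]) (ω : Fin m → ℝ[X]) : Prop where
  state : ∀ i, ξ i = X * (∑ j, S.A i j • ξ j + ∑ j, S.B i j • ω j)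
  output : ∀ i, ∑ j, S.C i j • ξ j + ∑ j, S.D i j • ω j = 0

open Polynomial in
theorem exists_isOutputNulling (v : Fin n → C(ℝ, ℝ)) (u : Fin m → C(ℝ, ℝ)) (hu : u ≠ 0)
    (hstate : ∀ i, v i = primitive (∑ j, S.A i j • v j + ∑ j, S.B i j • u j))
    (hout : ∀ i, ∑ j, S.C i j • v j + ∑ j, S.D i j • u j = 0) :
    ∃ ξ ω, S.IsOutputNulling ξ ω ∧ ω ≠ 0 := by
  have := isTorsionFree_aeval_primitive
  let e := Module.AEval'.of primitive
  let w : Fin n ⊕ Fin m → Module.AEval' primitive := Sum.elim (fun i => e (v i)) (fun j => e (u j))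
  have hC : ∀ (a : ℝ) (f : C(ℝ, ℝ)), e (a • f) = (Polynomial.C a : ℝ[X]) • e f := fun a f => by
    rw [← Module.AEval.of_aeval_smul]
    simp [e, Module.AEval'.of, Algebra.algebraMap_eq_smul_one]
  have hX : ∀ f : C(ℝ, ℝ), e (primitive f) = (X : ℝ[X]) • e f :=
    fun f => (Module.AEval'.X_smul_of primitive f).symm
  -- The functional is chosen not to vanish on a nonzero input component, which makes `ω ≠ 0`.
  obtain ⟨k, hk⟩ := Function.ne_iff.1 hu
  obtain ⟨f, hf⟩ := exists_functional_ne_zero (R := ℝ[X]) w (Sum.inr k)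
    (by simpa [w] using hk)
  let W : Fin n ⊕ Fin m → Submodule.span ℝ[X] (range w) :=
    fun i => ⟨w i, Submodule.subset_span (mem_range_self i)⟩
  refine ⟨fun i => f (W (Sum.inl i)), fun j => f (W (Sum.inr j)), ⟨fun i => ?_, fun i => ?_⟩,
    fun h => hf (congrFun h k)⟩
  · have h1 : W (Sum.inl i) = (X : ℝ[X]) • (∑ j, (Polynomial.C (S.A i j) : ℝ[X]) • W (Sum.inl j) +
        ∑ j, (Polynomial.C (S.B i j) : ℝ[X]) • W (Sum.inr j)) := by
      apply Subtype.ext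
      have := congrArg e (hstate i)
      rw [hX, map_add, map_sum, map_sum] at this
      simp only [hC] at this
      simpa [W, w] using this
    simpa [smul_eq_C_mul, mul_add] using congrArg f h1
  · have h1 : ∑ j, (Polynomial.C (S.C i j) : ℝ[X]) • W (Sum.inl j) +
        ∑ j, (Polynomial.C (S.D i j) : ℝ[X]) • W (Sum.inr j) = 0 := by
      apply Subtype.ext
      have := congrArg e (hout i)
      rw [map_add, map_sum, map_sum, map_zero] at this
      simp only [hC] at this
      simpa [W, w] using this
    simpa [smul_eq_C_mul, mul_add] using congrArg f h1

end LinearSystem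

/-! ### Continuity and integrability of signals. -/

namespace Signal

variable {k : ℕ}

theorem continuousWithinAt_of_mem_continuitySet {f : Signal k} {t : ℝ}
    (ht : t ∈ f.continuitySet) : 0 ≤ t ∧ ContinuousWithinAt f (Ici 0) t := by
  obtain ⟨O, ⟨⟨W, hW, rfl⟩, hc⟩, htO⟩ := ht
  refine ⟨htO.2, (hc t htO).mono_of_mem_nhdsWithin ?_⟩
  exact inter_mem (mem_nhdsWithin_of_mem_nhds (hW.mem_nhds htO.1)) self_mem_nhdsWithin

/-- A signal that is continuous from the right at an inner point of a set stays in this set for a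
short time, with a uniform margin. -/
theorem exists_uniform_margin {f : Signal k} {V : Set (Fin k → ℝ)} {t : ℝ} (ht : 0 ≤ t)
    (hf : ContinuousWithinAt f (Ici 0) t) (hV : f t ∈ interior V) :
    ∃ δ > 0, ∃ r > 0, ∀ s ∈ Icc t (t + δ), ∀ h : Fin k → ℝ, ‖h‖ ≤ r → f s + h ∈ V := by
  obtain ⟨r, hr, hball⟩ := Metric.mem_nhds_iff.1 (mem_interior_iff_mem_nhds.1 hV)
  obtain ⟨δ, hδ, hd⟩ := Metric.continuousWithinAt_iff.1 hf (r / 2) (half_pos hr)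
  -- Halving `δ` fits a closed interval into the open condition; `r / 2 + r / 3 < r` leaves room for
  -- `h`.
  refine ⟨δ / 2, half_pos hδ, r / 3, by positivity, fun s hs h hh => hball ?_⟩
  have h1 : dist (f s) (f t) < r / 2 := by
    refine hd (ht.trans hs.1) ?_
    rw [Real.dist_eq, abs_of_nonneg (by linarith [hs.1])]
    linarith [hs.2]
  rw [Metric.mem_ball]
  calc dist (f s + h) (f t) ≤ dist (f s + h) (f s) + dist (f s) (f t) := dist_triangle _ _ _
    _ < r := by rw [dist_self_add_left]; linarith

end Signal

/-- On `[0, T]` the input is bounded, and continuous off a finite null set; at negative times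
causality makes it zero. -/
theorem intervalIntegrable_of_mem_freeInputs {m : ℕ} {u : Signal m} (hu : u ∈ freeInputs m)
    (a b : ℝ) : IntervalIntegrable u volume a b := by
  obtain ⟨hc, ⟨hfin, -, -⟩, M, c, hM⟩ := hu
  have hpos : ∀ T : ℝ, IntegrableOn u (Icc 0 T) := by
    intro T
    set F := {t : ℝ | t ∈ Icc 0 T ∧ ¬ ContinuousWithinAt u (Ici 0) t}
    have hF : F.Finite := hfin T
    have hcont : ContinuousOn u (Icc 0 T \ F) := by
      intro t ht
      have : ContinuousWithinAt u (Ici 0) t := by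
        by_contra h
        exact ht.2 ⟨ht.1, h⟩
      exact this.mono fun s hs => hs.1.1
    have hmeas : AEStronglyMeasurable u (volume.restrict (Icc 0 T \ F)) :=
      hcont.aestronglyMeasurable (measurableSet_Icc.diff hF.measurableSet)
    have hae : (Icc 0 T \ F : Set ℝ) =ᵐ[volume] Icc 0 T :=
      sdiff_null_ae_eq_self (hF.measure_zero volume)
    rw [Measure.restrict_congr_set hae] at hmeas
    refine Integrable.of_bound hmeas (|M| * Real.exp (|c| * T)) ?_
    filter_upwards [ae_restrict_mem measurableSet_Icc] with t ht
    refine (hM t ht.1).trans ?_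
    have h1 : c * t ≤ |c| * T := by
      have := mul_le_mul_of_nonneg_right (le_abs_self c) ht.1
      have := mul_le_mul_of_nonneg_left ht.2 (abs_nonneg c)
      linarith
    exact mul_le_mul (le_abs_self M) (Real.exp_le_exp.2 h1) (Real.exp_pos _).le (abs_nonneg M)
  have hneg : ∀ T : ℝ, IntegrableOn u (Ico (-T) 0) := fun T =>
    integrableOn_zero.congr_fun (fun t ht => (hc t ht.2).symm) measurableSet_Ico
  refine IntegrableOn.intervalIntegrable
    (((hneg (max |a| |b|)).union (hpos (max |a| |b|))).mono_set fun t ht => ?_)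
  have h1 : -(max |a| |b|) ≤ t := by
    rcases le_total a b with h | h <;> simp only [h, uIcc_of_le, uIcc_of_ge] at ht
    · linarith [ht.1, neg_abs_le a, le_max_left |a| |b|]
    · linarith [ht.1, neg_abs_le b, le_max_right |a| |b|]
  have h2 : t ≤ max |a| |b| := by
    rcases le_total a b with h | h <;> simp only [h, uIcc_of_le, uIcc_of_ge] at ht
    · linarith [ht.2, le_abs_self b, le_max_right |a| |b|]
    · linarith [ht.2, le_abs_self a, le_max_left |a| |b|]
  rcases lt_or_ge t 0 with h | h
  · exact Or.inl ⟨h1, h⟩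
  · exact Or.inr ⟨h, h2⟩

theorem Matrix.intervalIntegrable_mulVec {k l : ℕ} (M : Matrix (Fin k) (Fin l) ℝ)
    {f : ℝ → Fin l → ℝ} {a b : ℝ} (hf : IntervalIntegrable f volume a b) :
    IntervalIntegrable (fun s => M.mulVec (f s)) volume a b :=
  ⟨(LinearMap.toContinuousLinearMap M.mulVecLin).integrable_comp hf.1,
    (LinearMap.toContinuousLinearMap M.mulVecLin).integrable_comp hf.2⟩

theorem intervalIntegral_pi_apply {k : ℕ} {f : ℝ → Fin k → ℝ} {a b : ℝ}
    (hf : IntervalIntegrable f volume a b) (i : Fin k) :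
    (∫ s in a..b, f s) i = ∫ s in a..b, f s i :=
  ((ContinuousLinearMap.proj (R := ℝ) (φ := fun _ : Fin k => ℝ) i).intervalIntegral_comp_comm
    hf).symm

theorem intervalIntegrable_pi_apply {k : ℕ} {f : ℝ → Fin k → ℝ} {a b : ℝ}
    (hf : IntervalIntegrable f volume a b) (i : Fin k) :
    IntervalIntegrable (fun s => f s i) volume a b :=
  ⟨(ContinuousLinearMap.proj (R := ℝ) (φ := fun _ : Fin k => ℝ) i).integrable_comp hf.1,
    (ContinuousLinearMap.proj (R := ℝ) (φ := fun _ : Fin k => ℝ) i).integrable_comp hf.2⟩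

/-- By Lebesgue differentiation `f` is almost everywhere the derivative of its primitive. -/
theorem ae_eq_zero_of_integral_eq_zero {f : ℝ → ℝ} (hf : ∀ a b, IntervalIntegrable f volume a b)
    (h : ∀ t, ∫ s in (0 : ℝ)..t, f s = 0) : ∀ᵐ t, f t = 0 := by
  have key : ∀ N : ℕ, ∀ᵐ t : ℝ, t ∈ uIcc (-N : ℝ) N → f t = 0 := by
    intro N
    filter_upwards [(hf (-N : ℝ) N).ae_hasDerivAt_integral] with t ht htN
    have h0 : (0 : ℝ) ∈ uIcc (-N : ℝ) N := by
      have : (0 : ℝ) ≤ N := N.cast_nonneg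
      rw [uIcc_of_le (by linarith)]
      exact ⟨by linarith, this⟩
    have h1 := ht htN 0 h0
    rw [funext h] at h1
    exact h1.unique (hasDerivAt_const t (0 : ℝ))
  filter_upwards [ae_all_iff.2 key] with t ht
  obtain ⟨N, hN⟩ := exists_nat_ge |t|
  refine ht N ?_
  rw [uIcc_of_le (by linarith [abs_nonneg t])]
  exact abs_le.1 hN

/-! ### Differences of trajectories. -/

namespace LinearSystem

variable {m n p : ℕ} (S : LinearSystem m n p)

variable {S} in
theorem IsStateTrajectory.intervalIntegrable {x₀ : Fin n → ℝ} {u : Signal m} {x : Signal n}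
    (hu : u ∈ freeInputs m) (hx : S.IsStateTrajectory x₀ u x) {t : ℝ} (ht : 0 ≤ t) :
    IntervalIntegrable (fun s => S.A.mulVec (x s) + S.B.mulVec (u s)) volume 0 t := by
  have hxi : IntervalIntegrable x volume 0 t := by
    refine (hx.1.mono fun s hs => ?_).intervalIntegrable
    rw [uIcc_of_le ht] at hs
    exact hs.1
  exact (S.A.intervalIntegrable_mulVec hxi).add
    (S.B.intervalIntegrable_mulVec (intervalIntegrable_of_mem_freeInputs hu 0 t))

variable {S} in
/-- The difference of two trajectories from the same initial state, extended by `0` to negative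
times, is a trajectory on the whole line. -/
theorem IsStateTrajectory.sub_eq_integral {x₀ : Fin n → ℝ} {u₁ u₂ : Signal m} {x₁ x₂ : Signal n}
    (hu₁ : u₁ ∈ freeInputs m) (hu₂ : u₂ ∈ freeInputs m)
    (h₁ : S.IsStateTrajectory x₀ u₁ x₁) (h₂ : S.IsStateTrajectory x₀ u₂ x₂) (t : ℝ) :
    (x₁ - x₂) (max t 0) =
      ∫ s in (0 : ℝ)..t, (S.A.mulVec ((x₁ - x₂) (max s 0)) + S.B.mulVec ((u₁ - u₂) s)) := by
  rcases le_total 0 t with ht | ht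
  · rw [max_eq_left ht, Pi.sub_apply, h₁.2 t ht, h₂.2 t ht, add_sub_add_left_eq_sub,
      ← intervalIntegral.integral_sub (h₁.intervalIntegrable hu₁ ht)
        (h₂.intervalIntegrable hu₂ ht)]
    refine intervalIntegral.integral_congr fun s hs => ?_
    rw [uIcc_of_le ht] at hs
    simp only [max_eq_left hs.1, Pi.sub_apply, Matrix.mulVec_sub]
    abel
  · have h0 : (x₁ - x₂) 0 = 0 := by
      rw [Pi.sub_apply, h₁.2 0 le_rfl, h₂.2 0 le_rfl]
      simp
    rw [max_eq_right ht, h0, eq_comm]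
    -- Causality says nothing at time 0, where the two inputs may differ.
    have hae : ∀ᵐ s : ℝ, s ≠ 0 := by simp [ae_iff]
    rw [intervalIntegral.integral_congr_ae (g := fun _ => 0), intervalIntegral.integral_zero]
    filter_upwards [hae] with s hs hst
    rw [uIoc_of_ge ht] at hst
    have hs0 : s < 0 := lt_of_le_of_ne hst.2 hs
    rw [max_eq_right hs0.le, h0, Pi.sub_apply, hu₁.1 s hs0, hu₂.1 s hs0]
    simp

theorem continuous_sub_max {k : ℕ} {x₁ x₂ : Signal k} (h₁ : ContinuousOn x₁ (Ici 0))
    (h₂ : ContinuousOn x₂ (Ici 0)) : Continuous fun t : ℝ => (x₁ - x₂) (max t 0) :=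
  (h₁.sub h₂).comp_continuous (by fun_prop) fun t => le_max_right t 0

variable {S} in
/-- Almost everywhere equal inputs produce the same state. -/
theorem IsStateTrajectory.eqOn {x₀ : Fin n → ℝ} {u₁ u₂ : Signal m} {x₁ x₂ : Signal n}
    (hu₁ : u₁ ∈ freeInputs m) (hu₂ : u₂ ∈ freeInputs m)
    (h₁ : S.IsStateTrajectory x₀ u₁ x₁) (h₂ : S.IsStateTrajectory x₀ u₂ x₂)
    (hu : Signal.AEEq u₁ u₂) : EqOn x₁ x₂ (Ici 0) := by
  have hz := eq_zero_of_eq_integral S.A.mulVecLin (continuous_sub_max h₁.1 h₂.1) fun t => by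
    rw [h₁.sub_eq_integral hu₁ hu₂ h₂ t]
    refine intervalIntegral.integral_congr_ae ?_
    have hae := (ae_restrict_iff' measurableSet_Ici).1 hu
    filter_upwards [hae] with s hs _
    have : (u₁ - u₂) s = 0 := by
      rcases lt_or_ge s 0 with h | h
      · rw [Pi.sub_apply, hu₁.1 s h, hu₂.1 s h, sub_zero]
      · rw [Pi.sub_apply, hs h, sub_self]
    simp [this]
  intro t ht
  have := congrFun hz t
  simp only [max_eq_left (mem_Ici.1 ht), Pi.sub_apply, Pi.zero_apply] at this
  exact sub_eq_zero.1 this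

open Polynomial in
/-- An input redundant system has a nonzero output nulling pair of polynomials. -/
theorem IsInputRedundant.exists_isOutputNulling (hS : S.IsInputRedundant univ univ) :
    ∃ ξ ω, S.IsOutputNulling ξ ω ∧ ω ≠ 0 := by
  obtain ⟨⟨x₀, y⟩, -, u₁, y₁, u₂, y₂, ⟨x₁, h₁⟩, ⟨x₂, h₂⟩, hne, hy, -⟩ := hS
  obtain ⟨hu₁, hx₁, hy₁⟩ := h₁.1
  obtain ⟨hu₂, hx₂, hy₂⟩ := h₂.1
  simp only at hu₁ hx₁ hy₁ hu₂ hx₂ hy₂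
  set z : Signal n := fun t => (x₁ - x₂) (max t 0)
  set w : Signal m := u₁ - u₂
  have hzc : Continuous z := continuous_sub_max hx₁.1 hx₂.1
  have hzi : ∀ a b, IntervalIntegrable z volume a b := hzc.intervalIntegrable
  have hwi : ∀ a b, IntervalIntegrable w volume a b := fun a b =>
    (intervalIntegrable_of_mem_freeInputs hu₁ a b).sub (intervalIntegrable_of_mem_freeInputs hu₂ a b)
  have hz : ∀ t, z t = ∫ s in (0 : ℝ)..t, (S.A.mulVec (z s) + S.B.mulVec (w s)) :=
    hx₁.sub_eq_integral hu₁ hu₂ hx₂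
  have hout : ∀ᵐ t : ℝ, S.C.mulVec (z t) + S.D.mulVec (w t) = 0 := by
    have hae := (ae_restrict_iff' measurableSet_Ici).1 ((hy₁.symm.trans hy).trans hy₂)
    filter_upwards [hae] with t ht
    rcases lt_or_ge t 0 with h | h
    · have h0 : z t = 0 := by
        simp only [z, max_eq_right h.le, Pi.sub_apply, hx₁.2 0 le_rfl, hx₂.2 0 le_rfl]
        simp
      have hw : w t = 0 := by simp only [w, Pi.sub_apply, hu₁.1 t h, hu₂.1 t h, sub_zero]
      simp [h0, hw]
    · simp only [z, w, max_eq_left h, Pi.sub_apply, Matrix.mulVec_sub]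
      rw [sub_add_sub_comm, ht h, sub_self]
  -- `w` need not be continuous, so the trajectory `(z, w)` is integrated once; its primitives are
  -- continuous and satisfy the same equations.
  let zc : Fin n → C(ℝ, ℝ) := fun i => ⟨fun t => z t i, (continuous_apply i).comp hzc⟩
  let wc : Fin m → C(ℝ, ℝ) := fun j => ⟨fun t => ∫ s in (0 : ℝ)..t, w s j,
    intervalIntegral.continuous_primitive
      (fun a b => intervalIntegrable_pi_apply (hwi a b) j) 0⟩
  have hint : ∀ {l : ℕ} (P : Matrix (Fin l) (Fin n) ℝ) (Q : Matrix (Fin l) (Fin m) ℝ) (t : ℝ)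
      (i : Fin l), (∑ j, P i j • primitive (zc j) + ∑ j, Q i j • wc j) t =
        (∫ s in (0 : ℝ)..t, (P.mulVec (z s) + Q.mulVec (w s))) i := by
    intro l P Q t i
    have hP := P.intervalIntegrable_mulVec (hzi 0 t)
    have hQ := Q.intervalIntegrable_mulVec (hwi 0 t)
    rw [intervalIntegral_pi_apply (hP.add hQ)]
    simp only [Pi.add_apply]
    rw [intervalIntegral.integral_add (intervalIntegrable_pi_apply hP i)
      (intervalIntegrable_pi_apply hQ i)]
    simp only [Matrix.mulVec, dotProduct]
    rw [intervalIntegral.integral_finsetSum fun j _ =>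
        (intervalIntegrable_pi_apply (hzi 0 t) j).const_mul _,
      intervalIntegral.integral_finsetSum fun j _ =>
        (intervalIntegrable_pi_apply (hwi 0 t) j).const_mul _]
    simp [primitive_apply, zc, wc, ContinuousMap.sum_apply]
  refine S.exists_isOutputNulling (fun i => primitive (zc i)) wc ?_ ?_ ?_
  · intro h0
    refine hne (ae_restrict_of_ae ?_)
    have : ∀ j, ∀ᵐ t : ℝ, w t j = 0 := fun j =>
      ae_eq_zero_of_integral_eq_zero (fun a b => intervalIntegrable_pi_apply (hwi a b) j)
        fun t => DFunLike.congr_fun (congrFun h0 j) t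
    filter_upwards [ae_all_iff.2 this] with t ht
    exact sub_eq_zero.1 (funext ht)
  · intro i
    refine congrArg primitive (ContinuousMap.ext fun t => ?_)
    rw [hint, ← hz]
    rfl
  · intro i
    ext t
    rw [hint, intervalIntegral.integral_congr_ae (g := fun _ => 0)
      (hout.mono fun s hs _ => hs), intervalIntegral.integral_zero]
    rfl

end LinearSystem

/-! ### Localized output nulling perturbations. -/

theorem add_mem_freeInputs {m : ℕ} {u w : Signal m} (hu : u ∈ freeInputs m) (hw : Continuous w)
    (hneg : ∀ t < 0, w t = 0) {K : ℝ} (hK : ∀ t, ‖w t‖ ≤ K) : u + w ∈ freeInputs m := by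
  obtain ⟨hc, ⟨hfin, hr, hl⟩, M, c, hM⟩ := hu
  have hK0 : 0 ≤ K := (norm_nonneg _).trans (hK 0)
  refine ⟨fun t ht => ?_, ⟨fun T => ?_, fun t ht => ?_, fun t ht => ?_⟩, |M| + K, |c|,
    fun t ht => ?_⟩
  · rw [Pi.add_apply, hc t ht, hneg t ht, add_zero]
  · exact (hfin T).subset fun t ht => ⟨ht.1, fun h => ht.2 (h.add hw.continuousWithinAt)⟩
  · obtain ⟨l, hl⟩ := hr t ht
    exact ⟨l + w t, hl.add (hw.tendsto t |>.mono_left nhdsWithin_le_nhds)⟩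
  · obtain ⟨l, hl⟩ := hl t ht
    exact ⟨l + w t, hl.add (hw.tendsto t |>.mono_left nhdsWithin_le_nhds)⟩
  · have h1 : Real.exp (c * t) ≤ Real.exp (|c| * t) :=
      Real.exp_le_exp.2 (mul_le_mul_of_nonneg_right (le_abs_self c) ht)
    have h2 : 1 ≤ Real.exp (|c| * t) := Real.one_le_exp (by positivity)
    calc ‖u t + w t‖ ≤ ‖u t‖ + ‖w t‖ := norm_add_le _ _
      _ ≤ M * Real.exp (c * t) + K := add_le_add (hM t ht) (hK t)
      _ ≤ |M| * Real.exp (|c| * t) + K * Real.exp (|c| * t) := by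
          refine add_le_add (mul_le_mul (le_abs_self M) h1 (Real.exp_pos _).le (abs_nonneg M)) ?_
          exact le_mul_of_one_le_right hK0 h2
      _ = (|M| + K) * Real.exp (|c| * t) := by ring

theorem exists_bound_of_continuous_of_support {k : ℕ} {f : Signal k} (hf : Continuous f) {a b : ℝ}
    (h : ∀ t, t ∉ Icc a b → f t = 0) : ∃ K > 0, ∀ t, ‖f t‖ ≤ K := by
  obtain ⟨K, hK⟩ := isCompact_Icc.exists_bound_of_continuousOn (s := Icc a b) hf.continuousOn
  refine ⟨max K 1, by positivity, fun t => ?_⟩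
  by_cases ht : t ∈ Icc a b
  · exact (hK t ht).trans (le_max_left _ _)
  · rw [h t ht, norm_zero]
    positivity

namespace LinearSystem

variable {m n p : ℕ} (S : LinearSystem m n p)

open Polynomial in
variable {S} in
/-- An output nulling pair yields compactly supported inputs that are invisible at the output and
steer the zero state to itself, on any given interval of positive times. -/
theorem IsOutputNulling.exists_signals {ξ : Fin n → ℝ[X]} {ω : Fin m → ℝ[X]}
    (h : S.IsOutputNulling ξ ω) (hω : ω ≠ 0) {a b : ℝ} (ha : 0 < a) (hab : a < b) :
    ∃ (w : Signal m) (z : Signal n), Continuous w ∧ Continuous z ∧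
      (∀ t, t ∉ Icc a b → w t = 0) ∧ (∀ t, t ∉ Icc a b → z t = 0) ∧ (∃ t, w t ≠ 0) ∧
      (ξ = 0 → z = 0) ∧
      (∀ t, z t = ∫ s in (0 : ℝ)..t, (S.A.mulVec (z s) + S.B.mulVec (w s))) ∧
      ∀ t, S.C.mulVec (z t) + S.D.mulVec (w t) = 0 := by
  -- The sum of all degrees is a common bound for the degrees of the `ξ i` and `ω j`.
  obtain ⟨ψ, hψ, hsupp⟩ := exists_aeval_primitive_support ha hab
    (∑ i, (ξ i).natDegree + ∑ j, (ω j).natDegree)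
  let zc : Fin n → C(ℝ, ℝ) := fun i => aeval primitive (ξ i) ψ
  let wc : Fin m → C(ℝ, ℝ) := fun j => aeval primitive (ω j) ψ
  have hzc : Continuous fun t i => zc i t := continuous_pi fun i => (zc i).continuous
  have hwc : Continuous fun t j => wc j t := continuous_pi fun j => (wc j).continuous
  refine ⟨fun t j => wc j t, fun t i => zc i t, hwc, hzc, fun t ht => ?_, fun t ht => ?_, ?_,
    fun h0 => ?_, fun t => ?_, fun t => ?_⟩
  · ext j
    refine hsupp _ ?_ t ht
    exact (Finset.single_le_sum (f := fun j => (ω j).natDegree) (fun _ _ => Nat.zero_le _)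
      (Finset.mem_univ j)).trans (Nat.le_add_left _ _)
  · ext i
    refine hsupp _ ?_ t ht
    exact (Finset.single_le_sum (f := fun i => (ξ i).natDegree) (fun _ _ => Nat.zero_le _)
      (Finset.mem_univ i)).trans (Nat.le_add_right _ _)
  -- A nonzero polynomial in the integration operator is injective, so `ω j ≠ 0` and `ψ ≠ 0` give a
  -- nonzero input.
  · by_contra! h0
    obtain ⟨j, hj⟩ := Function.ne_iff.1 hω
    exact hψ (eq_zero_of_aeval_primitive_eq_zero hj
      (ContinuousMap.ext fun t => congrFun (h0 t) j))
  · ext t i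
    simp [zc, h0]
  · ext i
    have hi : IntervalIntegrable (fun s => S.A.mulVec (fun i => zc i s) +
        S.B.mulVec (fun j => wc j s)) volume 0 t :=
      (S.A.intervalIntegrable_mulVec (hzc.intervalIntegrable 0 t)).add
        (S.B.intervalIntegrable_mulVec (hwc.intervalIntegrable 0 t))
    rw [intervalIntegral_pi_apply hi]
    have h1 : zc i = primitive (∑ j, S.A i j • zc j + ∑ j, S.B i j • wc j) := by
      simp only [zc]
      conv_lhs => rw [h.state i]
      simp [LinearMap.sum_apply, wc]
    change zc i t = _
    rw [h1, primitive_apply]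
    simp [Matrix.mulVec, dotProduct, ContinuousMap.sum_apply]
  · ext i
    have h1 : ∑ j, S.C i j • zc j + ∑ j, S.D i j • wc j = 0 := by
      have := congrArg (fun q : ℝ[X] => aeval primitive q ψ) (h.output i)
      simpa [LinearMap.sum_apply, zc, wc] using this
    have h2 := DFunLike.congr_fun h1 t
    simpa [Matrix.mulVec, dotProduct, ContinuousMap.sum_apply] using h2

open Polynomial in
/-- If the constraints leave a margin at a time of continuity of the input, then a small output
nulling perturbation gives a second input with the same output. -/
theorem exists_triples_ne {U : Set (Fin m → ℝ)} {X : Set (Fin n → ℝ)} {x₀ : Fin n → ℝ}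
    {u : Signal m} {x : Signal n} {y : Signal p} (hq : (u, x, y) ∈ S.triples U X x₀)
    {ξ : Fin n → ℝ[X]} {ω : Fin m → ℝ[X]} (h : S.IsOutputNulling ξ ω) (hω : ω ≠ 0) {t : ℝ}
    (ht : t ∈ u.continuitySet) (hU : u t ∈ interior U) (hX : ξ = 0 ∨ x t ∈ interior X) :
    ∃ (u' : Signal m) (x' : Signal n), (u', x', y) ∈ S.triples U X x₀ ∧ ¬ Signal.AEEq u u' := by
  obtain ⟨⟨hu, hx, hy⟩, ⟨huU, -⟩, ⟨hxX, -⟩, hyo⟩ := hq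
  simp only at hu hx hy huU hxX hyo
  obtain ⟨ht0, htc⟩ := Signal.continuousWithinAt_of_mem_continuitySet ht
  obtain ⟨δ₁, hδ₁, r₁, hr₁, hm₁⟩ := Signal.exists_uniform_margin ht0 htc hU
  -- When `ξ = 0` the state is not perturbed, so no margin in `X` is needed and the constants 1 are
  -- arbitrary.
  have hX' : ∃ δ > 0, ∃ r > 0, ∀ s ∈ Icc t (t + δ), ∀ h : Fin n → ℝ, (ξ = 0 → h = 0) →
      ‖h‖ ≤ r → x s + h ∈ X := by
    rcases hX with hξ | hX
    · refine ⟨1, one_pos, 1, one_pos, fun s hs h hh _ => ?_⟩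
      rw [hh hξ, add_zero]
      exact hxX s (ht0.trans hs.1)
    · obtain ⟨δ, hδ, r, hr, hm⟩ := Signal.exists_uniform_margin ht0 (hx.1 t ht0) hX
      exact ⟨δ, hδ, r, hr, fun s hs h _ => hm s hs h⟩
  obtain ⟨δ₂, hδ₂, r₂, hr₂, hm₂⟩ := hX'
  have hδ : 0 < min δ₁ δ₂ := lt_min hδ₁ hδ₂
  -- The support starts strictly after `t`, hence at a positive time even if `t = 0`, and ends while
  -- both margins still hold.
  obtain ⟨w, z, hwc, hzc, hws, hzs, ⟨τ, hτ⟩, hz0, hzi, hzo⟩ := h.exists_signals hω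
    (a := t + min δ₁ δ₂ / 2) (b := t + min δ₁ δ₂) (by positivity) (by linarith)
  have hneg : ∀ s < 0, s ∉ Icc (t + min δ₁ δ₂ / 2) (t + min δ₁ δ₂) := fun s hs hs' => by
    linarith [hs'.1]
  obtain ⟨K₁, hK₁, hb₁⟩ := exists_bound_of_continuous_of_support hwc hws
  obtain ⟨K₂, hK₂, hb₂⟩ := exists_bound_of_continuous_of_support hzc hzs
  obtain ⟨ε, hε, he₁, he₂⟩ : ∃ ε > 0, ε * K₁ ≤ r₁ ∧ ε * K₂ ≤ r₂ :=
    ⟨min (r₁ / K₁) (r₂ / K₂), by positivity,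
      (le_div_iff₀ hK₁).1 (min_le_left _ _), (le_div_iff₀ hK₂).1 (min_le_right _ _)⟩
  have hn₁ : ∀ s, ‖(ε • w) s‖ ≤ r₁ := fun s => by
    rw [Pi.smul_apply, norm_smul, Real.norm_of_nonneg hε.le]
    exact (mul_le_mul_of_nonneg_left (hb₁ s) hε.le).trans he₁
  have hn₂ : ∀ s, ‖(ε • z) s‖ ≤ r₂ := fun s => by
    rw [Pi.smul_apply, norm_smul, Real.norm_of_nonneg hε.le]
    exact (mul_le_mul_of_nonneg_left (hb₂ s) hε.le).trans he₂
  have hu' : u + ε • w ∈ freeInputs m :=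
    add_mem_freeInputs hu (hwc.const_smul ε) (fun s hs => by simp [hws s (hneg s hs)]) hn₁
  have hx'c : ContinuousOn (x + ε • z) (Ici 0) := hx.1.add (hzc.const_smul ε).continuousOn
  refine ⟨u + ε • w, x + ε • z, ⟨⟨hu', ⟨hx'c, fun s hs => ?_⟩, ?_⟩,
    ⟨fun s hs => ?_, hu'⟩, ⟨fun s hs => ?_, hx'c⟩, hyo⟩, fun hae => ?_⟩
  · have hzw : IntervalIntegrable (fun s => S.A.mulVec (z s) + S.B.mulVec (w s)) volume 0 s :=
      (S.A.intervalIntegrable_mulVec (hzc.intervalIntegrable 0 s)).add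
        (S.B.intervalIntegrable_mulVec (hwc.intervalIntegrable 0 s))
    have hzw' : IntervalIntegrable (fun s => ε • (S.A.mulVec (z s) + S.B.mulVec (w s)))
        volume 0 s := hzw.smul ε
    dsimp only
    rw [Pi.add_apply, Pi.smul_apply, hx.2 s hs, hzi s, ← intervalIntegral.integral_smul, add_assoc,
      ← intervalIntegral.integral_add (hx.intervalIntegrable hu hs) hzw']
    congr 2
    ext r : 1
    simp only [Pi.add_apply, Pi.smul_apply, Matrix.mulVec_add, Matrix.mulVec_smul, smul_add]
    abel
  · filter_upwards [hy] with s hs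
    rw [hs]
    simp only [Pi.add_apply, Pi.smul_apply, Matrix.mulVec_add, Matrix.mulVec_smul]
    rw [add_add_add_comm, ← smul_add, hzo s, smul_zero, add_zero]
  · by_cases hsI : s ∈ Icc (t + min δ₁ δ₂ / 2) (t + min δ₁ δ₂)
    · exact hm₁ s ⟨by linarith [hsI.1], hsI.2.trans (by gcongr; exact min_le_left _ _)⟩ _ (hn₁ s)
    · simpa [hws s hsI] using huU s hs
  · by_cases hsI : s ∈ Icc (t + min δ₁ δ₂ / 2) (t + min δ₁ δ₂)
    · exact hm₂ s ⟨by linarith [hsI.1], hsI.2.trans (by gcongr; exact min_le_right _ _)⟩ _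
        (fun h0 => by simp [hz0 h0]) (hn₂ s)
    · simpa [hzs s hsI] using hxX s hs
  · have hw0 : w =ᵐ[volume] fun _ => 0 := by
      filter_upwards [(ae_restrict_iff' measurableSet_Ici).1 hae] with s hs
      rcases lt_or_ge s 0 with h0 | h0
      · exact hws s (hneg s h0)
      · have := hs h0
        simpa [hε.ne'] using this
    exact hτ (congrFun ((hwc.ae_eq_iff_eq volume continuous_const).1 hw0) τ)

open Polynomial in
/-- If `ker B ∩ ker D ≠ 0`, there is an output nulling pair with zero state. -/
theorem exists_isOutputNulling_of_rho_pos (hρ : 0 < S.rho) :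
    ∃ ω : Fin m → ℝ[X], S.IsOutputNulling 0 ω ∧ ω ≠ 0 := by
  have := Module.finrank_pos_iff.1 hρ
  obtain ⟨⟨v, hB, hD⟩, hv⟩ := exists_ne
    (0 : (LinearMap.ker S.B.mulVecLin ⊓ LinearMap.ker S.D.mulVecLin : Submodule ℝ (Fin m → ℝ)))
  refine ⟨fun j => Polynomial.C (v j), ⟨fun i => ?_, fun i => ?_⟩, fun h0 => hv ?_⟩
  · have h1 : ∑ j, S.B i j * v j = 0 := congrFun (LinearMap.mem_ker.1 hB) i
    simp only [smul_C, smul_eq_mul, ← map_sum, h1]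
    simp
  · have h1 : ∑ j, S.D i j * v j = 0 := congrFun (LinearMap.mem_ker.1 hD) i
    simp only [smul_C, smul_eq_mul, ← map_sum, h1]
    simp
  · ext j
    simpa using congrFun h0 j

end LinearSystem

/-! ### The theorem. -/

theorem corollary2 {m n p : ℕ} (S : LinearSystem m n p)
    (U : Set (Fin m → ℝ)) (X : Set (Fin n → ℝ))
    (hS : S.IsInputRedundant Set.univ Set.univ)
    (x₀ : Fin n → ℝ) (y : Signal p)
    (hadm : (x₀, y) ∈ S.admissiblePairs U X)
    (hnot : (x₀, y) ∉ S.redundantPairs U X) :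
    (∃ (u : Signal m) (x : Signal n), (u, x, y) ∈ S.triples U X x₀) ∧
    (∀ (u₁ u₂ : Signal m) (x₁ x₂ : Signal n),
      (u₁, x₁, y) ∈ S.triples U X x₀ → (u₂, x₂, y) ∈ S.triples U X x₀ →
        Signal.AEEq u₁ u₂ ∧ Set.EqOn x₁ x₂ (Set.Ici 0)) ∧
    (∀ (u : Signal m) (x : Signal n), (u, x, y) ∈ S.triples U X x₀ →
      (0 < S.rho → ∀ t ∈ u.continuitySet, u t ∈ U \ interior U) ∧
      (S.rho = 0 → ∀ t ∈ u.continuitySet,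
        u t ∈ U \ interior U ∨ x t ∈ X \ interior X)) := by
  have huniq : ∀ (u₁ u₂ : Signal m) (x₁ x₂ : Signal n), (u₁, x₁, y) ∈ S.triples U X x₀ →
      (u₂, x₂, y) ∈ S.triples U X x₀ → Signal.AEEq u₁ u₂ := by
    intro u₁ u₂ x₁ x₂ h₁ h₂
    by_contra hne
    exact hnot ⟨hadm.1, u₁, y, u₂, y, ⟨x₁, h₁⟩, ⟨x₂, h₂⟩, hne, ae_eq_rfl, ae_eq_rfl⟩
  refine ⟨hadm.2, fun u₁ u₂ x₁ x₂ h₁ h₂ => ⟨huniq u₁ u₂ x₁ x₂ h₁ h₂, ?_⟩, fun u x hq => ⟨?_, ?_⟩⟩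
  · exact h₁.1.2.1.eqOn h₁.1.1 h₂.1.1 h₂.1.2.1 (huniq u₁ u₂ x₁ x₂ h₁ h₂)
  · intro hρ t ht
    refine ⟨hq.2.1.1 t (Signal.continuousWithinAt_of_mem_continuitySet ht).1, fun hU => ?_⟩
    obtain ⟨ω, h, hω⟩ := S.exists_isOutputNulling_of_rho_pos hρ
    obtain ⟨u', x', hq', hne⟩ := S.exists_triples_ne hq h hω ht hU (Or.inl rfl)
    exact hne (huniq _ _ _ _ hq hq')
  · intro _ t ht
    have ht0 := (Signal.continuousWithinAt_of_mem_continuitySet ht).1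
    by_contra! hcon
    have hU : u t ∈ interior U := by
      by_contra hU
      exact hcon.1 ⟨hq.2.1.1 t ht0, hU⟩
    have hX : x t ∈ interior X := by
      by_contra hX
      exact hcon.2 ⟨hq.2.2.1.1 t ht0, hX⟩
    obtain ⟨ξ, ω, h, hω⟩ := hS.exists_isOutputNulling
    obtain ⟨u', x', hq', hne⟩ := S.exists_triples_ne hq h hω ht hU (Or.inr hX)
    exact hne (huniq _ _ _ _ hq hq')
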